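/- Let $N\ge 3$ be odd, let $V_N=\mathbb Z/N\mathbb Z$ be the cycle on $N$ vertices, and for $\epsilon>0$ let $K$ be the Markov kernel of the random walk on $V_N$ with weight $1+\epsilon$ on the edge $\{0,1\}$ and weight $1$ on every other edge; that is, \[ K(x,y)=\begin{cases}(1+\epsilon)/(2+\epsilon), & (x,y)\in\{(0,1),(1,0)\},\\ 1/(2+\epsilon), & (x,y)\in\{(0,-1),(1,2)\},\\ 1/2, & y-x=\pm1,\ x\notin\{0,1\},\\ 0, & y-x\ne\pm1.\end{cases} \] For a permutation $g$ of $V_N$ put $\widetilde K(x,y)=K(x,g^{-1}y)$ and $K_i(x,y)=K(g^{i-1}x,g^{i-1}y)$ for $i\ge1$. Let $K_{0,0}=I$, $K_{0,n}=K_1K_2\cdots K_n$, and for $\eta>0$ define the relative-sup merging time of $(K_i)_{i\ge1}$ by \[ T_\infty(\eta)=\min\Bigl\{n\ge 0:\ \max_{x,y,z\in V_N}\Bigl|\frac{K_{0,n}(x,z)}{K_{0,n}(y,z)}-1\Bigr|<\eta\Bigr\}\in\{0,1,2,\dots\}\cup\{\infty\}, \] where the maximum is understood to be $\infty$ if some $K_{0,n}(y,z)=0$.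 (1) For all $\epsilon>0$ and $c\ge1$ there is a constant $C=C(\epsilon,c)>0$ such that, for every odd $N\ge3$, every permutation $g$ of $V_N$ and every invariant probability measure $\widetilde\pi$ of $\widetilde K$ satisfying $\max_{x}\widetilde\pi(x)\le c\,\min_{x}\widetilde\pi(x)$, \[ T_\infty(\eta)\le C\,N^2\,\bigl(1+\log_+(1/\eta)\bigr)\qquad\text{for all }\eta>0, \] where $\log_+t=\max(0,\log t)$. (2) For every $\epsilon>0$ and every odd $N\ge 3$, if $g(x)=x-1$ or $g(x)=x+2$ (mod $N$), then $\widetilde K$ has an invariant probability measure, and every such measure $\widetilde\pi$ satisfies $\max_x\widetilde\pi(x)\le(1+\epsilon)\min_x\widetilde\pi(x)$; so the hypothesis of (1) holds with $c=1+\epsilon$. -/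

import Mathlib

noncomputable section

namespace CircleWave

open scoped ENNReal

/-- The kernels `K_i(x,y) = K(g^{i-1} x, g^{i-1} y)`, `i = 1, 2, …`
(the value at `i = 0` is never used). -/
def shiftedKernel {V : Type*} (K : Matrix V V ℝ) (g : Equiv.Perm V) (i : ℕ) : Matrix V V ℝ :=
  Matrix.of fun x y => K ((g ^ (i - 1)) x) ((g ^ (i - 1)) y)

/-- The time inhomogeneous transition matrix `K_{0,n}` of the chain driven by a sequence
`K_1, K_2, …`: `K_{0,0} = I` and `K_{0,n+1} = K_{0,n} K_{n+1}`. -/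
def transition {V : Type*} [Fintype V] [DecidableEq V] (Ks : ℕ → Matrix V V ℝ) :
    ℕ → Matrix V V ℝ
  | 0 => 1
  | n + 1 => transition Ks n * Ks (n + 1)

/-- The relative-sup distance `max_x |μ(x)/ν(x) - 1|`, with values in `[0,∞]`. It is `∞` as soon
as some denominator vanishes. -/
def relSupDist {V : Type*} (μ ν : V → ℝ) : ℝ≥0∞ :=
  ⨆ x, if ν x = 0 then ⊤ else ENNReal.ofReal |μ x / ν x - 1|

/-- The relative-sup merging time
`T_∞(η) = min {n : max_{x,y,z} |K_{0,n}(x,z)/K_{0,n}(y,z) - 1| < η}` of the chain driven by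
`K_1, K_2, …`, with value `∞` if there is no such `n`. -/
def relSupMergingTime {V : Type*} [Fintype V] [DecidableEq V] (Ks : ℕ → Matrix V V ℝ)
    (η : ℝ) : ℕ∞ :=
  ⨅ (n : ℕ) (_ : (⨆ (x) (y), relSupDist (transition Ks n x) (transition Ks n y))
    < ENNReal.ofReal η), (n : ℕ∞)

/-- The kernel `K̃(x,y) = K(x, g⁻¹ y)`. -/
def tildeKernel {V : Type*} (K : Matrix V V ℝ) (g : Equiv.Perm V) : Matrix V V ℝ :=
  Matrix.of fun x y => K x (g⁻¹ y)

/-- `π` is an invariant probability measure of the kernel `P` on the finite set `V`. -/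
structure IsInvariantProb {V : Type*} [Fintype V] (P : Matrix V V ℝ) (π : V → ℝ) : Prop where
  nonneg : ∀ x, 0 ≤ π x
  sum_eq_one : ∑ x, π x = 1
  invariant : ∀ y, ∑ x, π x * P x y = π y

/-- Random walk on the cycle `ℤ/N` with weight `1` on all edges except the edge `{0,1}`, which has
weight `1 + ε`. -/
def circleKernel (N : ℕ) (ε : ℝ) : Matrix (ZMod N) (ZMod N) ℝ :=
  Matrix.of fun x y =>
    if (x = 0 ∧ y = 1) ∨ (x = 1 ∧ y = 0) then (1 + ε) / (2 + ε)
    else if (x = 0 ∧ y = -1) ∨ (x = 1 ∧ y = 2) then 1 / (2 + ε)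
    else if y = x + 1 ∨ y = x - 1 then 1 / 2
    else 0

end CircleWave

end

/-!
For a permutation `g` the chain driven by the shifted kernels is, up to a relabelling of the columns,
the time homogeneous chain driven by `K̃` (`transition_shiftedKernel_apply`). So the merging time
is controlled by the convergence of `K̃ ^ n x z / π z` to `1`, where `π` is the given invariant
measure of `K̃`.

For an invariant `π` the energy `‖f‖² - ‖P f‖²` in `ℓ²(π)` is the `π`-average of the variances of
`f` under the rows of `P` (`energy_eq_sum_variance`). Each row of `K̃`, and each row of its time
reversal with respect to `π`, gives mass bounded below to two points at distance two of the cycle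
(relabelled by `g` in the case of `K̃`). As `N` is odd, the steps by two form a single cycle of
length `N`, so by Cauchy–Schwarz the energy is at least `A (f x - f y)²` for all `x, y`, with `A` of
order `N⁻²`: one factor `1 / N` comes from `π` and one from the length of the cycle.

No Nash inequality is needed to avoid a factor `log N`. If `φ` is a probability density with respect
to `π`, its variance `v` satisfies both `v ≤ max φ - min φ` (as `∫ φ² ≤ max φ` and `min φ ≤ 1`) and
`v ≤ (max φ - min φ)²`. Hence `v` loses at least `A v²` and at least `A v` in each step
(`decay_of_density`). The former brings `v` below `1` by time `1 / A`, wherever it started, and the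
latter makes it decay exponentially from then on (`le_exp_of_decay`). Applying this to `K̃` and
to its time reversal, and the Cauchy–Schwarz inequality in `ℓ²(π)`, yields the uniform bound
`abs_pow_div_sub_one_le`.

For `g x = x - 1` the invariance of `π` says that `π x * K x (x - 1)` is unchanged by `x ↦ x + 2`,
hence constant (`le_mul_of_sub_one`). For `g x = x + 2` the value `π y` is the average of
`π (y - 1)` and `π (y - 3)` except at `y = 1, 2, 3, 4`, so the extrema of `π` are attained at these
points, where the four exceptional equations bound their ratio (`le_mul_of_add_two`).
-/

namespace CircleWave

open Finset Matrix
open scoped ENNReal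

/-! ### Variance decay for a kernel with a Dirichlet form bound -/

section Decay

variable {V : Type*} [Fintype V]

/-- The energy lost by `f` in one step of the kernel `P`, that is `‖f‖² - ‖P f‖²` in `ℓ²(π)`.
When `π` is invariant this is the Dirichlet form of `P* P`. -/
def energy (P : Matrix V V ℝ) (π f : V → ℝ) : ℝ :=
  ∑ x, π x * f x ^ 2 - ∑ x, π x * (P *ᵥ f) x ^ 2

/-- The time reversal of `P` with respect to `π`: the adjoint of `P` on `ℓ²(π)`. -/
noncomputable def reversal (P : Matrix V V ℝ) (π : V → ℝ) : Matrix V V ℝ :=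
  Matrix.of fun x y => π y * P y x / π x

/-- A probability vector charging two points with masses `p a` and `p b` gives `f` a variance of at
least `p a * p b * (f a - f b) ^ 2`. -/
lemma mul_mul_sq_sub_le_variance {p : V → ℝ} (hp : ∀ x, 0 ≤ p x) (hp1 : ∑ x, p x = 1)
    (f : V → ℝ) {a b : V} (hab : a ≠ b) :
    p a * p b * (f a - f b) ^ 2 ≤ ∑ x, p x * f x ^ 2 - (∑ x, p x * f x) ^ 2 := by
  classical
  set m := ∑ x, p x * f x with hm
  have hvar : ∑ x, p x * f x ^ 2 - m ^ 2 = ∑ x, p x * (f x - m) ^ 2 := by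
    have : ∀ x, p x * (f x - m) ^ 2 = p x * f x ^ 2 - 2 * m * (p x * f x) + m ^ 2 * p x :=
      fun x => by ring
    simp only [this, sum_add_distrib, sum_sub_distrib, ← mul_sum, hp1, ← hm]
    ring
  have hpair : p a * (f a - m) ^ 2 + p b * (f b - m) ^ 2 ≤ ∑ x, p x * (f x - m) ^ 2 := by
    rw [← sum_pair (f := fun x => p x * (f x - m) ^ 2) hab]
    exact sum_le_univ_sum_of_nonneg fun x => mul_nonneg (hp x) (sq_nonneg _)
  have hle : p a + p b ≤ 1 := by
    rw [← sum_pair (f := p) hab, ← hp1]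
    exact sum_le_univ_sum_of_nonneg hp
  rw [hvar]
  refine le_trans ?_ hpair
  have h0 : 0 ≤ p a * (f a - m) ^ 2 + p b * (f b - m) ^ 2 :=
    add_nonneg (mul_nonneg (hp a) (sq_nonneg _)) (mul_nonneg (hp b) (sq_nonneg _))
  nlinarith [mul_nonneg (sub_nonneg.2 hle) h0, sq_nonneg (p a * (f a - m) + p b * (f b - m))]

variable {P : Matrix V V ℝ} {π : V → ℝ}

lemma IsInvariantProb.sum_mul_mulVec (hπ : IsInvariantProb P π) (f : V → ℝ) :
    ∑ x, π x * (P *ᵥ f) x = ∑ x, π x * f x := by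
  have h : π ᵥ* P = π := funext fun y => hπ.invariant y
  change π ⬝ᵥ (P *ᵥ f) = π ⬝ᵥ f
  rw [dotProduct_mulVec, h]

lemma energy_eq_sum_variance (hπ : IsInvariantProb P π) (f : V → ℝ) :
    energy P π f = ∑ z, π z * (∑ x, P z x * f x ^ 2 - (∑ x, P z x * f x) ^ 2) := by
  simp only [mul_sub, sum_sub_distrib]
  rw [energy, ← hπ.sum_mul_mulVec fun x => f x ^ 2]
  rfl

/-- The variance `v` of a probability density `φ` is at most the oscillation of `φ` as well as at
most its square; so an energy bound by the squared oscillation gives both a linear and a quadratic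
rate of decay. -/
lemma decay_of_density [Nonempty V] (hπ : IsInvariantProb P π) {A : ℝ} (hA : 0 ≤ A)
    (hE : ∀ (f : V → ℝ) x y, A * (f x - f y) ^ 2 ≤ energy P π f) {φ : V → ℝ}
    (hφ : ∀ x, 0 ≤ φ x) (hφ1 : ∑ x, π x * φ x = 1) :
    0 ≤ ∑ x, π x * φ x ^ 2 - 1 ∧
    A * (∑ x, π x * φ x ^ 2 - 1) ≤ energy P π φ ∧
    A * (∑ x, π x * φ x ^ 2 - 1) ^ 2 ≤ energy P π φ := by
  obtain ⟨x, hx⟩ := Finite.exists_max φ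
  obtain ⟨y, hy⟩ := Finite.exists_min φ
  have hsum (t : ℝ) : ∑ z, π z * t = t := by rw [← sum_mul, hπ.sum_eq_one, one_mul]
  have hMx : 1 ≤ φ x := by
    rw [← hφ1, ← hsum (φ x)]
    exact sum_le_sum fun z _ => mul_le_mul_of_nonneg_left (hx z) (hπ.nonneg z)
  have hmy : φ y ≤ 1 := by
    rw [← hφ1, ← hsum (φ y)]
    exact sum_le_sum fun z _ => mul_le_mul_of_nonneg_left (hy z) (hπ.nonneg z)
  have hvar : ∑ z, π z * φ z ^ 2 - 1 = ∑ z, π z * (φ z - 1) ^ 2 := by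
    have : ∀ z, π z * (φ z - 1) ^ 2 = π z * φ z ^ 2 - 2 * (π z * φ z) + π z := fun z => by ring
    simp only [this, sum_add_distrib, sum_sub_distrib, ← mul_sum, hφ1, hπ.sum_eq_one]
    ring
  have h0 : 0 ≤ ∑ z, π z * φ z ^ 2 - 1 := by
    rw [hvar]
    exact sum_nonneg fun z _ => mul_nonneg (hπ.nonneg z) (sq_nonneg _)
  have h1 : ∑ z, π z * φ z ^ 2 - 1 ≤ φ x - φ y := by
    have : ∑ z, π z * φ z ^ 2 ≤ φ x := by
      calc ∑ z, π z * φ z ^ 2 ≤ ∑ z, φ x * (π z * φ z) := sum_le_sum fun z _ => by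
            nlinarith [mul_nonneg (mul_nonneg (hπ.nonneg z) (hφ z)) (sub_nonneg.2 (hx z))]
        _ = φ x := by rw [← mul_sum, hφ1, mul_one]
    linarith
  have h2 : ∑ z, π z * φ z ^ 2 - 1 ≤ (φ x - φ y) ^ 2 := by
    rw [hvar, ← hsum ((φ x - φ y) ^ 2)]
    refine sum_le_sum fun z _ => mul_le_mul_of_nonneg_left ?_ (hπ.nonneg z)
    exact sq_le_sq' (by linarith [hx z, hy z]) (by linarith [hx z, hy z])
  refine ⟨h0, (mul_le_mul_of_nonneg_left h2 hA).trans (hE φ x y),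
    (mul_le_mul_of_nonneg_left ?_ hA).trans (hE φ x y)⟩
  exact pow_le_pow_left₀ h0 h1 2

variable [DecidableEq V]

/-- If each point `z` is sent to each of two distinct points `α z`, `β z` with probability at least
`p`, the energy dominates the sum of the squared increments of `f` along the pairs
`α z`, `β z`. -/
lemma mul_sum_sq_sub_le_energy (hP : P ∈ rowStochastic ℝ V) (hπ : IsInvariantProb P π)
    {b p : ℝ} (hbπ : ∀ x, b ≤ π x) (hp : 0 ≤ p) {α β : V → V}
    (hne : ∀ z, α z ≠ β z) (hα : ∀ z, p ≤ P z (α z)) (hβ : ∀ z, p ≤ P z (β z)) (f : V → ℝ) :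
    b * p ^ 2 * ∑ z, (f (α z) - f (β z)) ^ 2 ≤ energy P π f := by
  rw [energy_eq_sum_variance hπ, mul_sum]
  refine sum_le_sum fun z _ => ?_
  have h1 := mul_mul_sq_sub_le_variance (fun x => hP.1 z x) (sum_row_of_mem_rowStochastic hP z) f
    (hne z)
  have h2 : p ^ 2 * (f (α z) - f (β z)) ^ 2 ≤ P z (α z) * P z (β z) * (f (α z) - f (β z)) ^ 2 := by
    rw [pow_two p]
    exact mul_le_mul_of_nonneg_right
      (mul_le_mul (hα z) (hβ z) hp (hP.1 _ _)) (sq_nonneg _)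
  have h3 : 0 ≤ p ^ 2 * (f (α z) - f (β z)) ^ 2 := by positivity
  rw [mul_assoc]
  exact mul_le_mul (hbπ z) (h2.trans h1) h3 (hπ.nonneg z)

/-- The quadratic decrement brings `v` below `1` by time `1 / A` whatever its initial value, and the
linear one makes it decay exponentially afterwards. -/
lemma le_exp_of_decay {v : ℕ → ℝ} {A : ℝ} (hA : 0 < A) (h0 : ∀ n, 0 ≤ v n)
    (h1 : ∀ n, A * v n ≤ v n - v (n + 1)) (h2 : ∀ n, A * v n ^ 2 ≤ v n - v (n + 1))
    {m : ℕ} (hm : 1 ≤ A * m) (k : ℕ) : v (m + k) ≤ Real.exp (-(A * k)) := by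
  have key : ∀ n : ℕ, A * n * v n ≤ 1 := by
    intro n
    induction n with
    | zero => simp
    | succ n ih =>
      have ht0 : 0 ≤ A * v n := mul_nonneg hA.le (h0 n)
      have ht1 : A * v n ≤ 1 := by
        by_contra! h
        nlinarith [h2 n, h0 n, h0 (n + 1), mul_pos hA (lt_of_mul_lt_mul_left
          (by simpa using one_pos.trans h : A * 0 < A * v n) hA.le)]
      have hs : A * v (n + 1) ≤ A * v n * (1 - A * v n) := by nlinarith [h2 n]
      have hs' : (n + 1 : ℝ) * (A * v (n + 1)) ≤ (n + 1) * (A * v n * (1 - A * v n)) :=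
        mul_le_mul_of_nonneg_left hs (by positivity)
      push_cast
      nlinarith [mul_le_mul_of_nonneg_right ih (sub_nonneg.2 ht1)]
  induction k with
  | zero =>
    have := mul_le_mul_of_nonneg_right hm (h0 m)
    simpa using (by linarith [key m] : v m ≤ 1)
  | succ k ih =>
    have hexp : Real.exp (-(A * (k + 1 : ℕ))) = Real.exp (-A) * Real.exp (-(A * k)) := by
      rw [← Real.exp_add]; congr 1; push_cast; ring
    rw [hexp, ← add_assoc]
    calc v (m + k + 1) ≤ (1 - A) * v (m + k) := by linarith [h1 (m + k)]
      _ ≤ Real.exp (-A) * v (m + k) :=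
        mul_le_mul_of_nonneg_right (by linarith [Real.add_one_le_exp (-A)]) (h0 _)
      _ ≤ _ := mul_le_mul_of_nonneg_left ih (Real.exp_pos _).le

lemma variance_pow_mulVec_le [Nonempty V] (hP : P ∈ rowStochastic ℝ V)
    (hπ : IsInvariantProb P π) {A : ℝ} (hA : 0 < A)
    (hE : ∀ (f : V → ℝ) x y, A * (f x - f y) ^ 2 ≤ energy P π f) {φ : V → ℝ}
    (hφ : ∀ x, 0 ≤ φ x) (hφ1 : ∑ x, π x * φ x = 1) {m : ℕ} (hm : 1 ≤ A * m) (k : ℕ) :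
    ∑ x, π x * ((P ^ (m + k)) *ᵥ φ) x ^ 2 - 1 ≤ Real.exp (-(A * k)) := by
  have hpos (n : ℕ) : ∀ x, 0 ≤ ((P ^ n) *ᵥ φ) x :=
    nonneg_mulVec_of_mem_rowStochastic (pow_mem hP n) hφ
  have hstep (n : ℕ) : (P ^ (n + 1)) *ᵥ φ = P *ᵥ ((P ^ n) *ᵥ φ) := by
    rw [pow_succ', mulVec_mulVec]
  have hone (n : ℕ) : ∑ x, π x * ((P ^ n) *ᵥ φ) x = 1 := by
    induction n with
    | zero => simpa using hφ1
    | succ n ih => rw [hstep, hπ.sum_mul_mulVec, ih]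
  have hd (n : ℕ) := decay_of_density hπ hA.le hE (hpos n) (hone n)
  have he (n : ℕ) : energy P π ((P ^ n) *ᵥ φ) =
      (∑ x, π x * ((P ^ n) *ᵥ φ) x ^ 2 - 1) - (∑ x, π x * ((P ^ (n + 1)) *ᵥ φ) x ^ 2 - 1) := by
    rw [hstep, energy]; ring
  exact le_exp_of_decay (v := fun n => ∑ x, π x * ((P ^ n) *ᵥ φ) x ^ 2 - 1) hA
    (fun n => (hd n).1) (fun n => he n ▸ (hd n).2.1) (fun n => he n ▸ (hd n).2.2) hm k

/-- The `χ²` distance decays: here the density `P ^ n (·, z) / π z` evolves by `P`. -/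
lemma sum_mul_sq_pow_div_sub_one_le [Nonempty V] (hP : P ∈ rowStochastic ℝ V)
    (hπ : IsInvariantProb P π) (hπ0 : ∀ x, 0 < π x) {A : ℝ} (hA : 0 < A)
    (hE : ∀ (f : V → ℝ) x y, A * (f x - f y) ^ 2 ≤ energy P π f)
    {m : ℕ} (hm : 1 ≤ A * m) (k : ℕ) (z : V) :
    ∑ x, π x * ((P ^ (m + k)) x z / π z - 1) ^ 2 ≤ Real.exp (-(A * k)) := by
  have hφ : ∀ x, 0 ≤ (Pi.single z (1 / π z) : V → ℝ) x := by
    intro x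
    by_cases h : x = z
    · subst h; simpa using (hπ0 x).le
    · simp [h]
  have hφ1 : ∑ x, π x * (Pi.single z (1 / π z) : V → ℝ) x = 1 := by
    simp [Pi.single_apply, (hπ0 z).ne']
  have hn (n : ℕ) (x : V) :
      ((P ^ n) *ᵥ (Pi.single z (1 / π z) : V → ℝ)) x = (P ^ n) x z / π z := by
    simp [div_eq_mul_inv]
  have hone (n : ℕ) : ∑ x, π x * ((P ^ n) x z / π z) = 1 := by
    induction n with
    | zero =>
      simp only [← hn]
      simpa only [pow_zero, one_mulVec] using hφ1
    | succ n ih =>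
      simp only [← hn] at ih ⊢
      rw [pow_succ', ← mulVec_mulVec, hπ.sum_mul_mulVec, ih]
  have h := variance_pow_mulVec_le hP hπ hA hE hφ hφ1 hm k
  simp only [hn] at h
  refine le_trans (le_of_eq ?_) h
  have (x : V) : π x * ((P ^ (m + k)) x z / π z - 1) ^ 2 =
      π x * ((P ^ (m + k)) x z / π z) ^ 2 - 2 * (π x * ((P ^ (m + k)) x z / π z)) + π x := by
    ring
  simp only [this, sum_add_distrib, sum_sub_distrib, ← mul_sum, hone, hπ.sum_eq_one]
  ring

lemma reversal_mem_rowStochastic (hP : P ∈ rowStochastic ℝ V) (hπ : IsInvariantProb P π)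
    (hπ0 : ∀ x, 0 < π x) : reversal P π ∈ rowStochastic ℝ V := by
  refine mem_rowStochastic_iff_sum.2 ⟨fun x y => ?_, fun x => ?_⟩
  · exact div_nonneg (mul_nonneg (hπ.nonneg y) (hP.1 y x)) (hπ.nonneg x)
  · simp only [reversal, of_apply, ← sum_div, hπ.invariant]
    exact div_self (hπ0 x).ne'

lemma isInvariantProb_reversal (hP : P ∈ rowStochastic ℝ V) (hπ : IsInvariantProb P π)
    (hπ0 : ∀ x, 0 < π x) : IsInvariantProb (reversal P π) π where
  nonneg := hπ.nonneg
  sum_eq_one := hπ.sum_eq_one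
  invariant y := by
    have (x : V) : π x * reversal P π x y = π y * P y x := by
      rw [reversal, of_apply, mul_div_cancel₀ _ (hπ0 x).ne']
    simp only [this, ← mul_sum, sum_row_of_mem_rowStochastic hP y, mul_one]

lemma reversal_pow (hπ0 : ∀ x, 0 < π x) (n : ℕ) :
    reversal P π ^ n = reversal (P ^ n) π := by
  induction n with
  | zero =>
    ext x y
    by_cases h : x = y
    · subst h; simp [reversal, (hπ0 x).ne']
    · simp [reversal, h, Ne.symm h]
  | succ n ih =>
    ext x y
    rw [pow_succ, ih, pow_succ']
    simp only [reversal, mul_apply, of_apply, mul_sum, sum_div]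
    refine sum_congr rfl fun w _ => ?_
    have := (hπ0 w).ne'
    field_simp

/-- Uniform convergence of the density: `P ^ (2 n) x z / π z - 1` is an inner product in `ℓ²(π)` of
the densities of `P ^ n` seen from `x` and from `z`; the first evolves by the time reversal of `P`
and the second by `P`. -/
lemma abs_pow_div_sub_one_le [Nonempty V] (hP : P ∈ rowStochastic ℝ V)
    (hπ : IsInvariantProb P π) (hπ0 : ∀ x, 0 < π x) {A : ℝ} (hA : 0 < A)
    (hE : ∀ (f : V → ℝ) x y, A * (f x - f y) ^ 2 ≤ energy P π f)
    (hE' : ∀ (f : V → ℝ) x y, A * (f x - f y) ^ 2 ≤ energy (reversal P π) π f)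
    {m : ℕ} (hm : 1 ≤ A * m) (k : ℕ) (x z : V) :
    |(P ^ (2 * (m + k))) x z / π z - 1| ≤ Real.exp (-(A * k)) := by
  have h1 := sum_mul_sq_pow_div_sub_one_le hP hπ hπ0 hA hE hm k z
  have h2 := sum_mul_sq_pow_div_sub_one_le (reversal_mem_rowStochastic hP hπ hπ0)
    (isInvariantProb_reversal hP hπ hπ0) hπ0 hA hE' hm k x
  rw [reversal_pow hπ0] at h2
  set n := m + k
  have hr (u : V) : reversal (P ^ n) π u x / π x = (P ^ n) x u / π u := by
    have := (hπ0 x).ne'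
    rw [reversal, of_apply]; field_simp
  simp only [hr] at h2
  have hPn := pow_mem hP n
  have hinv : ∑ u, π u * ((P ^ n) u z / π z) = 1 := by
    have h (k : ℕ) : ∑ u, π u * (P ^ k) u z = π z := by
      have hv : π ᵥ* P = π := funext fun y => hπ.invariant y
      have : π ᵥ* P ^ k = π := by
        induction k with
        | zero => simp
        | succ k ih => rw [pow_succ, ← vecMul_vecMul, ih, hv]
      exact congrFun this z
    simp only [← mul_div_assoc, ← sum_div, h]
    exact div_self (hπ0 z).ne'
  have hprod : (P ^ (2 * n)) x z / π z - 1 =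
      ∑ u, π u * ((P ^ n) x u / π u - 1) * ((P ^ n) u z / π z - 1) := by
    have (u : V) : π u * ((P ^ n) x u / π u - 1) * ((P ^ n) u z / π z - 1) =
        (P ^ n) x u * (P ^ n) u z / π z - (P ^ n) x u - π u * ((P ^ n) u z / π z) + π u := by
      have := (hπ0 u).ne'
      field_simp; ring
    simp only [this, sum_add_distrib, sum_sub_distrib, hinv, hπ.sum_eq_one,
      sum_row_of_mem_rowStochastic hPn, ← sum_div]
    rw [two_mul, pow_add, mul_apply]; ring
  -- Cauchy–Schwarz in `ℓ²(π)`, with the elementary inequality `|ab| ≤ (a² + b²) / 2` sufficing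
  -- since both norms have the same bound.
  rw [hprod]
  calc |∑ u, π u * ((P ^ n) x u / π u - 1) * ((P ^ n) u z / π z - 1)|
      ≤ ∑ u, |π u * ((P ^ n) x u / π u - 1) * ((P ^ n) u z / π z - 1)| :=
        abs_sum_le_sum_abs _ _
    _ ≤ ∑ u, (π u * ((P ^ n) x u / π u - 1) ^ 2 + π u * ((P ^ n) u z / π z - 1) ^ 2) / 2 := by
        refine sum_le_sum fun u _ => ?_
        rw [mul_assoc, abs_mul, abs_of_pos (hπ0 u), ← mul_add, mul_div_assoc]
        refine mul_le_mul_of_nonneg_left ?_ (hπ0 u).le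
        rw [abs_le]
        constructor <;> nlinarith [sq_nonneg ((P ^ n) x u / π u - 1 + ((P ^ n) u z / π z - 1)),
          sq_nonneg ((P ^ n) x u / π u - 1 - ((P ^ n) u z / π z - 1))]
    _ ≤ Real.exp (-(A * k)) := by
        rw [← sum_div, sum_add_distrib]; linarith

end Decay

/-! ### The merging time and powers of `K̃` -/

section Merging

variable {V : Type*} [Fintype V] [DecidableEq V]

/-- Up to a relabelling of the columns, the time inhomogeneous chain is the time homogeneous chain
driven by `K̃`. -/
lemma transition_shiftedKernel_apply (K : Matrix V V ℝ) (g : Equiv.Perm V) (n : ℕ) (x z : V) :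
    transition (shiftedKernel K g) n x z = (tildeKernel K g ^ n) x ((g ^ n) z) := by
  induction n generalizing z with
  | zero => simp [transition]
  | succ n ih =>
    rw [transition, pow_succ, mul_apply, mul_apply,
      ← Equiv.sum_comp (g ^ n) fun u => (tildeKernel K g ^ n) x u * _]
    refine sum_congr rfl fun w _ => ?_
    rw [ih]
    simp [shiftedKernel, tildeKernel, pow_succ']

lemma abs_div_sub_one_le {a b δ : ℝ} (ha : |a - 1| ≤ δ) (hb : |b - 1| ≤ δ) (hδ : δ ≤ 1 / 2) :
    |a / b - 1| ≤ 4 * δ := by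
  rw [abs_le] at ha hb
  have hb0 : 0 < b := by linarith
  have hδ0 : 0 ≤ δ := by linarith
  have : a / b - 1 = (a - b) / b := by field_simp
  rw [this, abs_div, abs_of_pos hb0, div_le_iff₀ hb0, abs_le]
  constructor <;> nlinarith

lemma relSupMergingTime_le {K : Matrix V V ℝ} {g : Equiv.Perm V} {π : V → ℝ}
    (hπ0 : ∀ x, 0 < π x) {n : ℕ} {δ η : ℝ} (hδ : δ ≤ 1 / 2) (hη : 0 < η) (hδη : 4 * δ < η)
    (h : ∀ x z, |(tildeKernel K g ^ n) x z / π z - 1| ≤ δ) :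
    relSupMergingTime (shiftedKernel K g) η ≤ n := by
  have hlt := (ENNReal.ofReal_lt_ofReal_iff hη).2 hδη
  rw [relSupMergingTime]
  refine iInf_le_of_le n (iInf_le _ (lt_of_le_of_lt ?_ hlt))
  refine iSup₂_le fun x y => iSup_le fun z => ?_
  have hx := h x ((g ^ n) z)
  have hy := h y ((g ^ n) z)
  have hz := hπ0 ((g ^ n) z)
  rw [transition_shiftedKernel_apply, transition_shiftedKernel_apply, if_neg]
  · refine ENNReal.ofReal_le_ofReal ?_
    rw [← div_div_div_cancel_right₀ hz.ne']
    exact abs_div_sub_one_le hx hy hδ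
  · intro h0
    rw [h0] at hy
    norm_num at hy
    linarith

/-- The merging time is of order `1 / A`, up to a factor logarithmic in `η`. -/
lemma relSupMergingTime_le_of_energy [Nonempty V] {K : Matrix V V ℝ} {g : Equiv.Perm V}
    {π : V → ℝ} (hP : tildeKernel K g ∈ rowStochastic ℝ V)
    (hπ : IsInvariantProb (tildeKernel K g) π) (hπ0 : ∀ x, 0 < π x) {A : ℝ} (hA : 0 < A)
    (hA1 : A ≤ 1)
    (hE : ∀ (f : V → ℝ) x y, A * (f x - f y) ^ 2 ≤ energy (tildeKernel K g) π f)
    (hE' : ∀ (f : V → ℝ) x y, A * (f x - f y) ^ 2 ≤ energy (reversal (tildeKernel K g) π) π f)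
    {η : ℝ} (hη : 0 < η) :
    ((relSupMergingTime (shiftedKernel K g) η : ℕ∞) : ℝ≥0∞) ≤
      ENNReal.ofReal (10 / A * (1 + Real.posLog (1 / η))) := by
  have hl0 : 0 ≤ Real.posLog (1 / η) := Real.posLog_nonneg
  have hl1 : Real.log (1 / η) ≤ Real.posLog (1 / η) := le_max_right _ _
  -- The exponent `l` is chosen so that `exp (-l) ≤ min (1/5) (η/5)`, as `e² > 5`.
  set l := 2 + Real.posLog (1 / η) with hl
  set m := ⌈1 / A⌉₊
  set k := ⌈l / A⌉₊
  have hm : 1 ≤ A * m := by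
    have := Nat.le_ceil (1 / A)
    rwa [div_le_iff₀' hA] at this
  have hk : l ≤ A * k := by
    have := Nat.le_ceil (l / A)
    rwa [div_le_iff₀' hA] at this
  have hexp2 : Real.exp (-2) < 1 / 5 := by
    rw [Real.exp_neg, inv_eq_one_div]
    refine one_div_lt_one_div_of_lt (by norm_num) ?_
    have : Real.exp 2 = Real.exp 1 ^ 2 := by rw [← Real.exp_nat_mul]; norm_num
    rw [this]
    nlinarith [Real.exp_one_gt_d9]
  have hδ : Real.exp (-(A * k)) ≤ 1 / 2 := by
    have : Real.exp (-(A * k)) ≤ Real.exp (-2) := Real.exp_le_exp.2 (by linarith)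
    linarith
  have hδη : 4 * Real.exp (-(A * k)) < η := by
    have h1 : Real.exp (-(A * k)) ≤ Real.exp (-2) * Real.exp (-Real.log (1 / η)) := by
      rw [← Real.exp_add]
      exact Real.exp_le_exp.2 (by linarith)
    have h2 : Real.exp (-Real.log (1 / η)) = η := by
      rw [one_div, Real.log_inv, neg_neg, Real.exp_log hη]
    rw [h2] at h1
    nlinarith
  have hT := relSupMergingTime_le hπ0 (n := 2 * (m + k)) hδ hη hδη
    (abs_pow_div_sub_one_le hP hπ hπ0 hA hE hE' hm k)
  refine (ENat.toENNReal_mono hT).trans ?_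
  rw [ENat.toENNReal_coe, ← ENNReal.ofReal_natCast]
  refine ENNReal.ofReal_le_ofReal ?_
  have hA1' : 1 ≤ 1 / A := by rwa [le_div_iff₀ hA, one_mul]
  have hm' : (m : ℝ) < 1 / A + 1 := Nat.ceil_lt_add_one (by positivity)
  have hk' : (k : ℝ) < l / A + 1 := Nat.ceil_lt_add_one (by positivity)
  have h3 : l / A = 2 * (1 / A) + Real.posLog (1 / η) * (1 / A) := by rw [hl]; ring
  have h4 : 10 / A * (1 + Real.posLog (1 / η)) =
    10 * (1 / A) + 10 * (Real.posLog (1 / η) * (1 / A)) := by ring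
  have h5 : 0 ≤ Real.posLog (1 / η) * (1 / A) := by positivity
  push_cast
  rw [h4]
  linarith

end Merging

/-! ### The walk on the cycle -/

section Cycle

variable {N : ℕ}

/-- The probability that the walk steps from `x` to `x + 1`. -/
noncomputable def stepUp (N : ℕ) (ε : ℝ) (x : ZMod N) : ℝ :=
  if x = 0 then (1 + ε) / (2 + ε) else if x = 1 then 1 / (2 + ε) else 1 / 2

/-- The probability that the walk steps from `x` to `x - 1`. -/
noncomputable def stepDown (N : ℕ) (ε : ℝ) (x : ZMod N) : ℝ :=
  if x = 0 then 1 / (2 + ε) else if x = 1 then (1 + ε) / (2 + ε) else 1 / 2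

lemma natCast_ne_natCast {a b : ℕ} (ha : a < N) (hb : b < N) (hab : a ≠ b) :
    (a : ZMod N) ≠ b := by
  rwa [Ne, ZMod.natCast_eq_natCast_iff', Nat.mod_eq_of_lt ha, Nat.mod_eq_of_lt hb]

lemma two_ne_zero_of_three_le (hN : 3 ≤ N) : (2 : ZMod N) ≠ 0 := by
  exact_mod_cast natCast_ne_natCast (N := N) (a := 2) (b := 0) (by omega) (by omega) (by simp)

lemma one_ne_zero_of_three_le (hN : 3 ≤ N) : (1 : ZMod N) ≠ 0 := fun h =>
  two_ne_zero_of_three_le hN (by rw [← one_add_one_eq_two, h, add_zero])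

lemma add_one_ne_sub_one (hN : 3 ≤ N) (x : ZMod N) : x + 1 ≠ x - 1 := fun h =>
  two_ne_zero_of_three_le hN (by linear_combination h)

lemma circleKernel_apply (hN : 3 ≤ N) (ε : ℝ) (x y : ZMod N) :
    circleKernel N ε x y =
      (if y = x + 1 then stepUp N ε x else 0) + (if y = x - 1 then stepDown N ε x else 0) := by
  have h1 := one_ne_zero_of_three_le hN
  have h2 := two_ne_zero_of_three_le hN
  have hne := add_one_ne_sub_one hN x
  have h12 : (1 : ZMod N) + 1 = 2 := one_add_one_eq_two
  rw [circleKernel, of_apply, stepUp, stepDown]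
  by_cases hx0 : x = 0
  · subst hx0
    have : (1 : ZMod N) ≠ -1 := by simpa using hne
    by_cases hy : y = 1
    · subst hy; simp [this, h1]
    · by_cases hy' : y = -1
      · subst hy'; simp [h1.symm, this.symm]
      · simp [hy, hy', h1.symm]
  · by_cases hx1 : x = 1
    · subst hx1
      by_cases hy : y = 0
      · subst hy; simp [h1, h12, h2.symm]
      · by_cases hy' : y = 2
        · subst hy'; simp [h1, h12, h2]
        · simp [hy, hy', h1, h12]
    · by_cases hy : y = x + 1
      · subst hy; simp [hx0, hx1, hne]
      · by_cases hy' : y = x - 1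
        · subst hy'; simp [hx0, hx1, hne.symm]
        · simp [hx0, hx1, hy, hy']

lemma stepUp_add_stepDown {ε : ℝ} (hε : 0 < ε) (x : ZMod N) :
    stepUp N ε x + stepDown N ε x = 1 := by
  rw [stepUp, stepDown]
  have : 2 + ε ≠ 0 := by positivity
  split_ifs <;> field_simp <;> ring

lemma le_stepUp {ε : ℝ} (hε : 0 < ε) (x : ZMod N) : 1 / (2 + ε) ≤ stepUp N ε x := by
  rw [stepUp]
  split_ifs
  · gcongr; linarith
  · exact le_rfl
  · gcongr; linarith

lemma le_stepDown {ε : ℝ} (hε : 0 < ε) (x : ZMod N) : 1 / (2 + ε) ≤ stepDown N ε x := by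
  rw [stepDown]
  split_ifs
  · exact le_rfl
  · gcongr; linarith
  · gcongr; linarith

lemma circleKernel_add_one (hN : 3 ≤ N) (ε : ℝ) (x : ZMod N) :
    circleKernel N ε x (x + 1) = stepUp N ε x := by
  simp [circleKernel_apply hN, add_one_ne_sub_one hN x]

lemma circleKernel_sub_one (hN : 3 ≤ N) (ε : ℝ) (x : ZMod N) :
    circleKernel N ε x (x - 1) = stepDown N ε x := by
  simp [circleKernel_apply hN, (add_one_ne_sub_one hN x).symm]

variable [NeZero N]

lemma circleKernel_mem_rowStochastic (hN : 3 ≤ N) {ε : ℝ} (hε : 0 < ε) :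
    circleKernel N ε ∈ rowStochastic ℝ (ZMod N) := by
  have hpos : 0 < 1 / (2 + ε) := by positivity
  refine mem_rowStochastic_iff_sum.2 ⟨fun x y => ?_, fun x => ?_⟩
  · rw [circleKernel_apply hN]
    have h1 := hpos.le.trans (le_stepUp hε x)
    have h2 := hpos.le.trans (le_stepDown hε x)
    split_ifs <;> linarith
  · simp [circleKernel_apply hN, sum_add_distrib, stepUp_add_stepDown hε]

lemma sum_mul_circleKernel (hN : 3 ≤ N) (ε : ℝ) (π : ZMod N → ℝ) (w : ZMod N) :
    ∑ x, π x * circleKernel N ε x w =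
      π (w - 1) * stepUp N ε (w - 1) + π (w + 1) * stepDown N ε (w + 1) := by
  have h1 (x : ZMod N) : w = x + 1 ↔ x = w - 1 := by
    rw [eq_comm, eq_sub_iff_add_eq]
  have h2 (x : ZMod N) : w = x - 1 ↔ x = w + 1 := by
    rw [eq_comm, sub_eq_iff_eq_add]
  simp [circleKernel_apply hN, mul_add, sum_add_distrib, h1, h2]

/-- As `N` is odd, the steps `z - 1 → z + 1` run through a single cycle. -/
lemma exists_eq_add_two_mul (hodd : Odd N) (x y : ZMod N) :
    ∃ k : ℕ, k < N ∧ y = x + 2 * (k : ZMod N) := by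
  have hc : Nat.Coprime 2 N := Nat.coprime_two_left.2 hodd
  refine ⟨((y - x) * ((ZMod.unitOfCoprime 2 hc)⁻¹ : (ZMod N)ˣ)).val, ZMod.val_lt _, ?_⟩
  rw [ZMod.natCast_zmod_val]
  have : (2 : ZMod N) = ((ZMod.unitOfCoprime 2 hc : (ZMod N)ˣ) : ZMod N) := by
    simp
  rw [this, mul_comm, mul_assoc, Units.inv_mul, mul_one, add_sub_cancel]

lemma sq_sub_le_mul_sum_sq (hodd : Odd N) (h : ZMod N → ℝ) (x y : ZMod N) :
    (h x - h y) ^ 2 ≤ N * ∑ z, (h (z + 1) - h (z - 1)) ^ 2 := by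
  obtain ⟨k, hk, rfl⟩ := exists_eq_add_two_mul hodd x y
  have htel : h (x + 2 * (k : ZMod N)) - h x =
      ∑ j ∈ range k, (h (x + 2 * ((j + 1 : ℕ) : ZMod N)) - h (x + 2 * (j : ZMod N))) := by
    rw [sum_range_sub fun j : ℕ => h (x + 2 * (j : ZMod N))]
    simp
  have hinj : Set.InjOn (fun j : ℕ => x + 2 * (j : ZMod N) + 1) (range k : Set ℕ) := by
    intro i hi j hj hij
    have hi' : i < N := (mem_range.1 hi).trans hk
    have hj' : j < N := (mem_range.1 hj).trans hk
    have h2 : IsUnit (2 : ZMod N) := by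
      simpa using (ZMod.unitOfCoprime 2 (Nat.coprime_two_left.2 hodd)).isUnit
    have : (i : ZMod N) = j := by
      apply h2.mul_left_cancel
      simpa using hij
    rw [ZMod.natCast_eq_natCast_iff'] at this
    rwa [Nat.mod_eq_of_lt hi', Nat.mod_eq_of_lt hj'] at this
  have hsum : ∑ j ∈ range k, (h (x + 2 * ((j + 1 : ℕ) : ZMod N)) - h (x + 2 * (j : ZMod N))) ^ 2 ≤
      ∑ z, (h (z + 1) - h (z - 1)) ^ 2 := by
    calc _ = ∑ z ∈ (range k).image (fun j : ℕ => x + 2 * (j : ZMod N) + 1),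
          (h (z + 1) - h (z - 1)) ^ 2 := by
          rw [sum_image hinj]
          refine sum_congr rfl fun j _ => ?_
          have : x + 2 * ((j + 1 : ℕ) : ZMod N) = x + 2 * (j : ZMod N) + 1 + 1 := by
            push_cast; ring
          rw [this, add_sub_cancel_right]
      _ ≤ _ := sum_le_univ_sum_of_nonneg fun z => sq_nonneg _
  rw [← neg_sub, neg_sq, htel]
  refine (sq_sum_le_card_mul_sum_sq).trans ?_
  rw [card_range]
  exact mul_le_mul (by exact_mod_cast hk.le) hsum (sum_nonneg fun _ _ => sq_nonneg _)
    (Nat.cast_nonneg N)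

lemma tildeKernel_mem_rowStochastic {V : Type*} [Fintype V] [DecidableEq V] {K : Matrix V V ℝ}
    (hK : K ∈ rowStochastic ℝ V) (g : Equiv.Perm V) : tildeKernel K g ∈ rowStochastic ℝ V := by
  refine mem_rowStochastic_iff_sum.2 ⟨fun x y => hK.1 _ _, fun x => ?_⟩
  rw [← sum_row_of_mem_rowStochastic hK x]
  exact Equiv.sum_comp g⁻¹ (K x)

lemma sq_sub_le_energy (hodd : Odd N) (hN : 3 ≤ N) {ε : ℝ} (hε : 0 < ε)
    {g : Equiv.Perm (ZMod N)} {π : ZMod N → ℝ}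
    (hπ : IsInvariantProb (tildeKernel (circleKernel N ε) g) π) {b : ℝ} (hb : 0 ≤ b)
    (hbπ : ∀ x, b ≤ π x) (f : ZMod N → ℝ) (x y : ZMod N) :
    b * (1 / (2 + ε)) ^ 2 / N * (f x - f y) ^ 2 ≤
      energy (tildeKernel (circleKernel N ε) g) π f := by
  have hN0 : (0 : ℝ) < N := by exact_mod_cast (by omega : 0 < N)
  have h1 := mul_sum_sq_sub_le_energy
    (tildeKernel_mem_rowStochastic (circleKernel_mem_rowStochastic hN hε) g) hπ hbπ
    (p := 1 / (2 + ε)) (by positivity) (α := fun z => g (z + 1)) (β := fun z => g (z - 1))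
    (fun z h => add_one_ne_sub_one hN z (g.injective h))
    (fun z => by simpa [tildeKernel, circleKernel_add_one hN] using le_stepUp hε z)
    (fun z => by simpa [tildeKernel, circleKernel_sub_one hN] using le_stepDown hε z) f
  have h2 := sq_sub_le_mul_sum_sq hodd (fun z => f (g z)) (g.symm x) (g.symm y)
  simp only [Equiv.apply_symm_apply] at h2
  refine le_trans ?_ h1
  rw [div_mul_eq_mul_div, mul_div_assoc]
  refine mul_le_mul_of_nonneg_left ?_ (by positivity)
  rwa [div_le_iff₀' hN0]

lemma sq_sub_le_energy_reversal (hodd : Odd N) (hN : 3 ≤ N) {ε : ℝ} (hε : 0 < ε)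
    {g : Equiv.Perm (ZMod N)} {π : ZMod N → ℝ}
    (hπ : IsInvariantProb (tildeKernel (circleKernel N ε) g) π) (hπ0 : ∀ x, 0 < π x) {b c : ℝ}
    (hb : 0 ≤ b) (hbπ : ∀ x, b ≤ π x) (hc : 0 < c) (hcπ : ∀ x y, π x ≤ c * π y)
    (f : ZMod N → ℝ) (x y : ZMod N) :
    b * (1 / (2 + ε) / c) ^ 2 / N * (f x - f y) ^ 2 ≤
      energy (reversal (tildeKernel (circleKernel N ε) g) π) π f := by
  have hN0 : (0 : ℝ) < N := by exact_mod_cast (by omega : 0 < N)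
  have hP := tildeKernel_mem_rowStochastic (circleKernel_mem_rowStochastic hN hε) g
  have hrev (u w : ZMod N) (h : 1 / (2 + ε) ≤ tildeKernel (circleKernel N ε) g u w) :
      1 / (2 + ε) / c ≤ reversal (tildeKernel (circleKernel N ε) g) π w u := by
    rw [reversal, of_apply, div_le_div_iff₀ hc (hπ0 w)]
    have h3 : 0 ≤ 1 / (2 + ε) := by positivity
    calc 1 / (2 + ε) * π w ≤ 1 / (2 + ε) * (c * π u) :=
          mul_le_mul_of_nonneg_left (hcπ w u) h3
      _ ≤ tildeKernel (circleKernel N ε) g u w * (c * π u) :=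
          mul_le_mul_of_nonneg_right h (mul_pos hc (hπ0 u)).le
      _ = _ := by ring
  have h1 := mul_sum_sq_sub_le_energy (reversal_mem_rowStochastic hP hπ hπ0)
    (isInvariantProb_reversal hP hπ hπ0) hbπ (p := 1 / (2 + ε) / c) (by positivity)
    (α := fun z => g⁻¹ z + 1) (β := fun z => g⁻¹ z - 1)
    (fun z => add_one_ne_sub_one hN _)
    (fun z => hrev _ _ <| by
      have := le_stepDown hε (g⁻¹ z + 1)
      rw [← circleKernel_sub_one hN, add_sub_cancel_right] at this
      exact this)
    (fun z => hrev _ _ <| by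
      have := le_stepUp hε (g⁻¹ z - 1)
      rw [← circleKernel_add_one hN, sub_add_cancel] at this
      exact this) f
  have h2 := sq_sub_le_mul_sum_sq hodd f x y
  rw [← Equiv.sum_comp g⁻¹] at h2
  refine le_trans ?_ h1
  rw [div_mul_eq_mul_div, mul_div_assoc]
  refine mul_le_mul_of_nonneg_left ?_ (by positivity)
  rwa [div_le_iff₀' hN0]

/-- The merging time bound, with the explicit constant `10 (2 + ε)² c³`. -/
theorem relSupMergingTime_circleKernel_le (hodd : Odd N) (hN : 3 ≤ N) {ε c : ℝ} (hε : 0 < ε)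
    (hc : 1 ≤ c) {g : Equiv.Perm (ZMod N)} {π : ZMod N → ℝ}
    (hπ : IsInvariantProb (tildeKernel (circleKernel N ε) g) π)
    (hcπ : (⨆ x, π x) ≤ c * ⨅ x, π x) {η : ℝ} (hη : 0 < η) :
    ((relSupMergingTime (shiftedKernel (circleKernel N ε) g) η : ℕ∞) : ℝ≥0∞) ≤
      ENNReal.ofReal (10 * (2 + ε) ^ 2 * c ^ 3 * (N : ℝ) ^ 2 * (1 + Real.posLog (1 / η))) := by
  have hN1 : (1 : ℝ) ≤ N := by exact_mod_cast (by omega : 1 ≤ N)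
  have hN0 : (0 : ℝ) < N := by linarith
  have hc0 : 0 < c := by linarith
  have hratio (x y : ZMod N) : π x ≤ c * π y :=
    (le_ciSup (Finite.bddAbove_range π) x).trans <| hcπ.trans <|
      mul_le_mul_of_nonneg_left (ciInf_le (Finite.bddBelow_range π) y) hc0.le
  have hbπ (y : ZMod N) : 1 / (c * N) ≤ π y := by
    have : ∑ x, π x ≤ ∑ _x : ZMod N, c * π y := sum_le_sum fun x _ => hratio x y
    rw [hπ.sum_eq_one, sum_const, card_univ, ZMod.card, nsmul_eq_mul] at this
    rw [div_le_iff₀ (by positivity)]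
    linarith
  have hb : 0 < 1 / (c * N) := by positivity
  have hπ0 (x : ZMod N) : 0 < π x := hb.trans_le (hbπ x)
  set A := 1 / (c * N) * (1 / (2 + ε) / c) ^ 2 / N with hA
  have hA0 : 0 < A := by positivity
  have hAinv : 10 / A = 10 * (2 + ε) ^ 2 * c ^ 3 * (N : ℝ) ^ 2 := by
    rw [hA]; field_simp
  have hA1 : A ≤ 1 := by
    have h1 : A = 1 / ((2 + ε) ^ 2 * c ^ 3 * (N : ℝ) ^ 2) := by
      rw [hA]; field_simp
    rw [h1, div_le_one (by positivity)]
    exact one_le_mul_of_one_le_of_one_le (one_le_mul_of_one_le_of_one_le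
      (one_le_pow₀ (by linarith)) (one_le_pow₀ hc)) (one_le_pow₀ hN1)
  rw [← hAinv]
  refine relSupMergingTime_le_of_energy
    (tildeKernel_mem_rowStochastic (circleKernel_mem_rowStochastic hN hε) g) hπ hπ0 hA0 hA1
    (fun f x y => ?_) (sq_sub_le_energy_reversal hodd hN hε hπ hπ0 hb.le hbπ hc0 hratio) hη
  refine le_trans ?_ (sq_sub_le_energy hodd hN hε hπ hb.le hbπ f x y)
  have : 1 / (2 + ε) / c ≤ 1 / (2 + ε) := div_le_self (by positivity) hc
  rw [hA]
  gcongr ?_ / _ * _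
  exact mul_le_mul_of_nonneg_left (pow_le_pow_left₀ (by positivity) this 2) hb.le

end Cycle

/-! ### Invariant measures -/

/-- A left eigenvector `v` for the eigenvalue `1` exists since there is a right one. The triangle
inequality gives `|v| ≤ |v| P`, and both sides have the same total mass. -/
lemma exists_isInvariantProb {V : Type*} [Fintype V] [DecidableEq V] [Nonempty V]
    {P : Matrix V V ℝ} (hP : P ∈ rowStochastic ℝ V) : ∃ π, IsInvariantProb P π := by
  have hdet : (P - 1).det = 0 := exists_mulVec_eq_zero_iff.1
    ⟨1, one_ne_zero, by rw [sub_mulVec, hP.2, one_mulVec, sub_self]⟩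
  obtain ⟨v, hv0, hv⟩ := exists_vecMul_eq_zero_iff.2 hdet
  have hv' (y : V) : ∑ x, v x * P x y = v y := by
    rw [vecMul_sub, vecMul_one, sub_eq_zero] at hv
    exact congrFun hv y
  have hle (y : V) : |v y| ≤ ∑ x, |v x| * P x y := by
    calc |v y| = |∑ x, v x * P x y| := by rw [hv']
      _ ≤ ∑ x, |v x * P x y| := abs_sum_le_sum_abs _ _
      _ = _ := sum_congr rfl fun x _ => by rw [abs_mul, abs_of_nonneg (hP.1 x y)]
  have htotal : ∑ y, |v y| = ∑ y, ∑ x, |v x| * P x y := by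
    rw [sum_comm]
    simp only [← mul_sum, sum_row_of_mem_rowStochastic hP, mul_one]
  have heq := (sum_eq_sum_iff_of_le fun y _ => hle y).1 htotal
  have hpos : 0 < ∑ x, |v x| := by
    obtain ⟨x, hx⟩ := Function.ne_iff.1 hv0
    exact sum_pos' (fun x _ => abs_nonneg _) ⟨x, mem_univ x, abs_pos.2 hx⟩
  refine ⟨fun x => |v x| / ∑ x, |v x|, fun x => by positivity, ?_, fun y => ?_⟩
  · rw [← sum_div, div_self hpos.ne']
  · rw [heq y (mem_univ y), sum_div]
    exact sum_congr rfl fun x _ => by ring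

/-- The elimination behind the bound for the forward rotation by two: `u₁, …, u₄` are the values of
the invariant measure after the exceptional edge and `a, b, c` the three preceding ones. -/
lemma mul_le_mul_of_four_point_system {s a b c u₁ u₂ u₃ u₄ m M : ℝ} (hs0 : 0 ≤ s)
    (hs : s < 1 / 2)
    (h₁ : u₁ = a / 2 + s * c) (h₂ : u₂ = b / 2 + (1 - s) * u₁) (h₃ : u₃ = u₂ / 2 + (1 - s) * c)
    (h₄ : u₄ = u₃ / 2 + s * u₁) (hm0 : 0 ≤ m)
    (haM : a ≤ M) (hbM : b ≤ M) (hcM : c ≤ M) (h₁M : u₁ ≤ M) (h₂M : u₂ ≤ M) (h₃M : u₃ ≤ M)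
    (ham : m ≤ a) (hbm : m ≤ b) (hcm : m ≤ c) (h₁m : m ≤ u₁) (h₂m : m ≤ u₂) (h₃m : m ≤ u₃)
    (hM : u₁ = M ∨ u₂ = M ∨ u₃ = M ∨ u₄ = M) (hm : u₁ = m ∨ u₂ = m ∨ u₃ = m ∨ u₄ = m) :
    s * M ≤ (1 - s) * m := by
  -- `u₁` and `u₄` are combinations of other values with total weight `1 / 2 + s < 1`, so they can
  -- only be maximal if `M ≤ 0`.
  have hzero (h : M ≤ (1 / 2 + s) * M) : s * M ≤ (1 - s) * m := by
    have hM0 : M ≤ 0 := by nlinarith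
    nlinarith [mul_nonneg hs0 (neg_nonneg.2 hM0)]
  have hsM : s * u₁ ≤ s * M := mul_le_mul_of_nonneg_left h₁M hs0
  have hscM : s * c ≤ s * M := mul_le_mul_of_nonneg_left hcM hs0
  -- The weights for `u₂` and `u₃` exceed `1`: a minimum at `u₂` entails one at `u₁`, and a minimum
  -- at `u₃` entails one at `u₂`.
  have hm' : u₁ = m ∨ u₄ = m := by
    have h2 (h : u₂ = m) : u₁ = m := by
      refine le_antisymm ?_ h₁m
      nlinarith
    rcases hm with h | h | h | h
    · exact Or.inl h
    · exact Or.inl (h2 h)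
    · refine Or.inl (h2 (le_antisymm ?_ h₂m))
      nlinarith
    · exact Or.inr h
  rcases hM with h | h | h | h
  · exact hzero (by linarith)
  · have h1 : M / 2 ≤ (1 - s) * u₁ := by linarith
    rcases hm' with h' | h'
    · rw [h'] at h1
      nlinarith
    · have h2 : s * u₁ ≤ m / 2 := by linarith
      nlinarith [mul_le_mul_of_nonneg_left h1 hs0]
  · rcases hm' with h' | h'
    · have h1 : M / 2 ≤ (1 - s) * c := by linarith
      have h2 : s * c ≤ m / 2 := by linarith
      nlinarith [mul_le_mul_of_nonneg_left h1 hs0]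
    · have h1 : s * m ≤ s * u₁ := mul_le_mul_of_nonneg_left h₁m hs0
      nlinarith
  · exact hzero (by linarith)

section Cycle

variable {N : ℕ} [NeZero N] {ε : ℝ} {π : ZMod N → ℝ} {g : Equiv.Perm (ZMod N)}

lemma IsInvariantProb.apply_circle (hN : 3 ≤ N)
    (hπ : IsInvariantProb (tildeKernel (circleKernel N ε) g) π) (w : ZMod N) :
    π (g w) = π (w - 1) * stepUp N ε (w - 1) + π (w + 1) * stepDown N ε (w + 1) := by
  rw [← hπ.invariant, ← sum_mul_circleKernel hN]
  simp [tildeKernel]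

/-- For the backward rotation, invariance says that `π x * stepDown N ε x` is invariant under
`x ↦ x + 2`, hence constant. -/
lemma le_mul_of_sub_one (hodd : Odd N) (hN : 3 ≤ N) (hε : 0 < ε) (hg : ∀ x, g x = x - 1)
    (hπ : IsInvariantProb (tildeKernel (circleKernel N ε) g) π) (x y : ZMod N) :
    π x ≤ (1 + ε) * π y := by
  have hstep (w : ZMod N) : π (w + 2) * stepDown N ε (w + 2) = π w * stepDown N ε w := by
    have h := hπ.apply_circle hN (w + 1)
    rw [hg, add_sub_cancel_right, add_assoc, one_add_one_eq_two] at h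
    linear_combination -h - π w * stepUp_add_stepDown hε w
  have hconst : π y * stepDown N ε y = π x * stepDown N ε x := by
    obtain ⟨k, -, rfl⟩ := exists_eq_add_two_mul hodd x y
    induction k with
    | zero => simp
    | succ k ih =>
      rw [← ih, ← hstep (x + 2 * (k : ZMod N))]
      have : x + 2 * ((k + 1 : ℕ) : ZMod N) = x + 2 * (k : ZMod N) + 2 := by push_cast; ring
      rw [this]
  have hpos : 0 < 1 / (2 + ε) := by positivity
  have hx := hpos.trans_le (le_stepDown hε x)
  have hy : stepDown N ε y ≤ (1 + ε) * stepDown N ε x := by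
    have h1 := le_stepUp hε y
    have h2 := le_stepDown hε x
    have h3 := stepUp_add_stepDown hε y
    have h4 : (1 + ε) * (1 / (2 + ε)) = 1 - 1 / (2 + ε) := by field_simp; ring
    nlinarith
  refine le_of_mul_le_mul_right ?_ hx
  rw [← hconst]
  calc π y * stepDown N ε y ≤ π y * ((1 + ε) * stepDown N ε x) :=
        mul_le_mul_of_nonneg_left hy (hπ.nonneg y)
    _ = _ := by ring

/-- A nonempty set of points of the cycle contains one of `1, 2, 3, 4` if it contains, with every
other point `y`, also `y - 1`. -/
lemma exists_mem_of_sub_one {S : ZMod N → Prop} {x : ZMod N} (hx : S x)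
    (h : ∀ y, S y → y ≠ 1 → y ≠ 2 → y ≠ 3 → y ≠ 4 → S (y - 1)) :
    S 1 ∨ S 2 ∨ S 3 ∨ S 4 := by
  by_contra! hcon
  obtain ⟨h1, h2, h3, h4⟩ := hcon
  have hall (k : ℕ) : S (x - k) := by
    induction k with
    | zero => simpa using hx
    | succ k ih =>
      have := h _ ih (fun e => h1 (e ▸ ih)) (fun e => h2 (e ▸ ih)) (fun e => h3 (e ▸ ih))
        (fun e => h4 (e ▸ ih))
      rwa [sub_sub, ← Nat.cast_succ] at this
  apply h1
  have := hall (x - 1).val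
  rwa [ZMod.natCast_zmod_val, sub_sub_cancel] at this

/-- For the forward rotation by two, `π y = (π (y - 1) + π (y - 3)) / 2` except at the four points
`1, 2, 3, 4`, so the maximum and the minimum of `π` are attained there. The four exceptional
equations exclude `1` and `4` for the maximum, `2` and `3` for the minimum, and bound the ratio in
the remaining cases. -/
lemma le_mul_of_add_two (hN : 5 ≤ N) (hε : 0 < ε) (hg : ∀ x, g x = x + 2)
    (hπ : IsInvariantProb (tildeKernel (circleKernel N ε) g) π) {x y : ZMod N}
    (hx : ∀ z, π z ≤ π x) (hy : ∀ z, π y ≤ π z) : π x ≤ (1 + ε) * π y := by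
  have hne (a b : ℕ) (h : a < 5 ∧ b < 5 ∧ a ≠ b) : (a : ZMod N) ≠ b :=
    natCast_ne_natCast (by omega) (by omega) h.2.2
  have h10 : (1 : ZMod N) ≠ 0 := by exact_mod_cast hne 1 0 (by decide)
  have h20 : (2 : ZMod N) ≠ 0 := by exact_mod_cast hne 2 0 (by decide)
  have h30 : (3 : ZMod N) ≠ 0 := by exact_mod_cast hne 3 0 (by decide)
  have h21 : (2 : ZMod N) ≠ 1 := by exact_mod_cast hne 2 1 (by decide)
  have h31 : (3 : ZMod N) ≠ 1 := by exact_mod_cast hne 3 1 (by decide)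
  have hrec (w : ZMod N) :
      π w = π (w - 3) * stepUp N ε (w - 3) + π (w - 1) * stepDown N ε (w - 1) := by
    have h := hπ.apply_circle (by omega) (w - 2)
    rw [hg, sub_add_cancel] at h
    rw [h]
    have e1 : w - 2 - 1 = w - 3 := by ring
    have e2 : w - 2 + 1 = w - 1 := by ring
    rw [e1, e2]
  have hgen (w : ZMod N) (w1 : w ≠ 1) (w2 : w ≠ 2) (w3 : w ≠ 3) (w4 : w ≠ 4) :
      π w = (π (w - 3) + π (w - 1)) / 2 := by
    have e1 : w - 3 ≠ 0 := sub_ne_zero.2 w3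
    have e2 : w - 3 ≠ 1 := fun h => w4 (by linear_combination h)
    have e3 : w - 1 ≠ 0 := sub_ne_zero.2 w1
    have e4 : w - 1 ≠ 1 := fun h => w2 (by linear_combination h)
    rw [hrec w, stepUp, stepDown, if_neg e1, if_neg e2, if_neg e3, if_neg e4]
    ring
  set s := 1 / (2 + ε) with hs
  have hs0 : 0 < s := by positivity
  have hs2 : s < 1 / 2 := one_div_lt_one_div_of_lt (by norm_num) (by linarith)
  have hs' : (1 + ε) / (2 + ε) = 1 - s := by rw [hs]; field_simp; ring
  have hr : (1 + ε) * s = 1 - s := by rw [hs]; field_simp; ring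
  have p1 : π 1 = π (1 - 3) / 2 + s * π 0 := by
    have e1 : (1 - 3 : ZMod N) ≠ 0 := fun h => h20 (by linear_combination -h)
    have e2 : (1 - 3 : ZMod N) ≠ 1 := fun h => h30 (by linear_combination -h)
    rw [hrec 1, stepUp, stepDown, if_neg e1, if_neg e2, sub_self, if_pos rfl]
    ring
  have p2 : π 2 = π (2 - 3) / 2 + (1 - s) * π 1 := by
    have e1 : (2 - 3 : ZMod N) ≠ 0 := fun h => h10 (by linear_combination -h)
    have e2 : (2 - 3 : ZMod N) ≠ 1 := fun h => h20 (by linear_combination -h)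
    have e3 : (2 - 1 : ZMod N) = 1 := by ring
    rw [hrec 2, stepUp, stepDown, if_neg e1, if_neg e2, e3, if_neg h10, if_pos rfl, hs']
    ring
  have p3 : π 3 = π 2 / 2 + (1 - s) * π 0 := by
    have e3 : (3 - 1 : ZMod N) = 2 := by ring
    rw [hrec 3, stepUp, stepDown, sub_self, if_pos rfl, e3, if_neg h20, if_neg h21, hs']
    ring
  have p4 : π 4 = π 3 / 2 + s * π 1 := by
    have e1 : (4 - 3 : ZMod N) = 1 := by ring
    have e3 : (4 - 1 : ZMod N) = 3 := by ring
    rw [hrec 4, stepUp, stepDown, e1, if_neg h10, if_pos rfl, e3, if_neg h30, if_neg h31]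
    ring
  obtain hM := exists_mem_of_sub_one (S := fun z => π z = π x) (x := x) rfl
    fun w hw w1 w2 w3 w4 => by
      have := hgen w w1 w2 w3 w4
      linarith [hx (w - 1), hx (w - 3)]
  obtain hm := exists_mem_of_sub_one (S := fun z => π z = π y) (x := y) rfl
    fun w hw w1 w2 w3 w4 => by
      have := hgen w w1 w2 w3 w4
      linarith [hy (w - 1), hy (w - 3)]
  have hm0 : 0 ≤ π y := hπ.nonneg y
  -- It suffices to show `s M ≤ (1 - s) m`, with `M` the maximum and `m` the minimum.
  suffices h : s * π x ≤ (1 - s) * π y by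
    rw [← hr] at h
    exact le_of_mul_le_mul_left (by linarith) hs0
  exact mul_le_mul_of_four_point_system hs0.le hs2 p1 p2 p3 p4 hm0 (hx _) (hx _) (hx 0) (hx 1)
    (hx 2) (hx 3) (hy _) (hy _) (hy 0) (hy 1) (hy 2) (hy 3) hM hm

end Cycle

end CircleWave

theorem mainTheorem4 :
    (∀ ε : ℝ, 0 < ε → ∀ c : ℝ, 1 ≤ c → ∃ C : ℝ, 0 < C ∧
      ∀ (N : ℕ) [NeZero N], Odd N → 3 ≤ N →
      ∀ (g : Equiv.Perm (ZMod N)) (π' : ZMod N → ℝ),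
        CircleWave.IsInvariantProb
          (CircleWave.tildeKernel (CircleWave.circleKernel N ε) g) π' →
        (⨆ x, π' x) ≤ c * (⨅ x, π' x) →
        ∀ η : ℝ, 0 < η →
          ((CircleWave.relSupMergingTime
              (CircleWave.shiftedKernel (CircleWave.circleKernel N ε) g) η : ℕ∞) : ENNReal) ≤
            ENNReal.ofReal (C * (N : ℝ) ^ 2 * (1 + Real.posLog (1 / η)))) ∧
    (∀ ε : ℝ, 0 < ε → ∀ (N : ℕ) [NeZero N], Odd N → 3 ≤ N →
      ∀ g : Equiv.Perm (ZMod N), ((∀ x, g x = x - 1) ∨ (∀ x, g x = x + 2)) →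
        (∃ π' : ZMod N → ℝ, CircleWave.IsInvariantProb
          (CircleWave.tildeKernel (CircleWave.circleKernel N ε) g) π') ∧
        ∀ π' : ZMod N → ℝ, CircleWave.IsInvariantProb
          (CircleWave.tildeKernel (CircleWave.circleKernel N ε) g) π' →
          (⨆ x, π' x) ≤ (1 + ε) * (⨅ x, π' x)) := by
  refine ⟨fun ε hε c hc => ⟨10 * (2 + ε) ^ 2 * c ^ 3, by positivity, ?_⟩, ?_⟩
  · intro N _ hodd hN g π' hπ hcπ η hη
    exact CircleWave.relSupMergingTime_circleKernel_le hodd hN hε hc hπ hcπ hη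
  · intro ε hε N _ hodd hN g hg
    refine ⟨CircleWave.exists_isInvariantProb (CircleWave.tildeKernel_mem_rowStochastic
      (CircleWave.circleKernel_mem_rowStochastic hN hε) g), fun π' hπ => ?_⟩
    obtain ⟨x, hx⟩ := exists_eq_ciSup_of_finite (f := π')
    obtain ⟨y, hy⟩ := exists_eq_ciInf_of_finite (f := π')
    rw [← hx, ← hy]
    rcases hg with hg | hg
    · exact CircleWave.le_mul_of_sub_one hodd hN hε hg hπ x y
    · by_cases hN5 : 5 ≤ N
      · exact CircleWave.le_mul_of_add_two hN5 hε hg hπ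
          (fun z => hx ▸ le_ciSup (Finite.bddAbove_range π') z)
          (fun z => hy ▸ ciInf_le (Finite.bddBelow_range π') z)
      · -- For `N = 3` the two rotations coincide.
        obtain rfl : N = 3 := by
          obtain ⟨k, hk⟩ := hodd
          omega
        have h3 : (2 : ZMod 3) = -1 := rfl
        exact CircleWave.le_mul_of_sub_one hodd hN hε
          (fun z => by rw [hg, h3, sub_eq_add_neg]) hπ x y
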